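/- All topological groups are Hausdorff. For a topological group $G$ let $c(G)$ denote the connected component of its neutral element, and for a topological space $X$ let $w(X)$ denote its weight, i.e. the least cardinality of a base of the topology of $X$. A subgroup $H$ of a topological Abelian group $G$ is called \emph{locally essential} in $G$ if there is a neighbourhood $V$ of $0$ in $G$ such that $H \cap N \neq \{0\}$ for every non-trivial closed subgroup $N$ of $G$ contained in $V$. A subgroup of $G$ is a \emph{$G_\delta$-subgroup} if it is a countable intersection of open subsets of $G$. Finally, $\dim$ denotes the Lebesgue covering dimension. Let $K$ be a compact Abelian group and let $M$ be a closed subgroup of $K$. Suppose that at least one of the following two conditions holds: (a) $M$ is a $G_\delta$-subgroup of $K$ and $c(M) \neq \{0\}$; (b) $M$ is a locally essential subgroup of $K$ and $\dim K$ is infinite. Then $w(c(M)) = w(c(K))$. -/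

import Mathlib

open Topology TopologicalSpace

universe u

noncomputable section

/-- The weight of a topological space: the least cardinality of a base of its topology. -/
def weight (X : Type u) [TopologicalSpace X] : Cardinal.{u} :=
  sInf {κ : Cardinal.{u} | ∃ B : Set (Set X), IsTopologicalBasis B ∧ Cardinal.mk B = κ}

/-- Every finite open cover of `X` has a finite open refinement (again covering `X`) such that
every point of `X` lies in at most `n` of its members; that is, the Lebesgue covering dimension
of `X` is less than `n`. -/
def HasCoveringDimensionLT (X : Type u) [TopologicalSpace X] (n : ℕ) : Prop :=
  ∀ U : Set (Set X), U.Finite → (∀ u ∈ U, IsOpen u) → ⋃₀ U = Set.univ →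
    ∃ V : Set (Set X), V.Finite ∧ (∀ v ∈ V, IsOpen v) ∧ ⋃₀ V = Set.univ ∧
      (∀ v ∈ V, ∃ u ∈ U, v ⊆ u) ∧ ∀ x : X, {v ∈ V | x ∈ v}.encard ≤ n

/-- The Lebesgue covering dimension. The empty space has dimension `⊥` (that is, `-1`), and the
value `⊤` means that the dimension is infinite. -/
def coveringDimension (X : Type u) [TopologicalSpace X] : WithBot ℕ∞ :=
  sInf {d : WithBot ℕ∞ | ∀ n : ℕ, d < n → HasCoveringDimensionLT X n}

/-- A subgroup `H` of a topological group `G` is locally essential if there is a neighbourhood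
`V` of the neutral element such that `H` meets non-trivially every non-trivial closed normal
subgroup of `G` that is contained in `V`. -/
def IsLocallyEssential {G : Type u} [AddGroup G] [TopologicalSpace G] (H : AddSubgroup G) : Prop :=
  ∃ V ∈ 𝓝 (0 : G), ∀ N : AddSubgroup G, N.Normal → IsClosed (N : Set G) → N ≠ ⊥ →
    (N : Set G) ⊆ V → H ⊓ N ≠ ⊥

end

/-! Since c(M) embeds in c(K), its weight is at most that of c(K). The converse counts characters.
Let C be compact and connected and let A be a set of characters of C with totally disconnected
common kernel. Every character is torsion on that kernel, so by the double annihilator theorem some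
positive multiple of it lies in ⟨A⟩. The dual of C is torsion-free, so it has at most ℵ₀·|⟨A⟩|
elements, and it separates points; this bounds w(C)
(`weight_le_of_totallyDisconnected_annihilator`).

This is applied to C = c(K) and to the restrictions of A ∪ B. Here A consists of at most w(c(M))
characters of K that separate 0 from the rest of c(M), and B is countable such that connected sets
through 0 in its annihilator lie in M. Such sets, if also killed by A, are trivial, and w(c(M)) is
infinite because c(M) ≠ 0.

In case (a), each of the countably many open sets contains the annihilator of a finite set of
characters, and B is the union of these finite sets. In case (b), let M^⊥ be the group of characters
vanishing on M. If M^⊥ had infinite rank, a homomorphism from the dual to ℚ mapping M^⊥ onto ℚ would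
yield a small non-trivial closed subgroup meeting M trivially. So a finite set S of characters
generates a positive multiple of each element of M^⊥, and B = S works. If c(M) were trivial, the
annihilator of S would be totally disconnected and dim K finite.

Enough characters are found by applying Gelfand theory to the regular representation on L²; the
double annihilator theorem then follows from Stone–Weierstrass and orthogonality. -/

/-! ### Continuous characters separate the points of a compact Abelian group -/

section UnitaryRepresentation

set_option linter.unusedSectionVars false

open MeasureTheory

variable {G : Type*} [AddCommGroup G] [TopologicalSpace G] [IsTopologicalAddGroup G]
  [CompactSpace G] [MeasurableSpace G] [BorelSpace G]
  {H : Type*} [NormedAddCommGroup H] [InnerProductSpace ℂ H] [CompleteSpace H]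

/-- The operator `g ↦ ∫ f(y) U(y) g dy` attached to a strongly continuous family `U` of contractions
and a continuous function `f`. -/
noncomputable def smearedOperator (μ : Measure G) [IsFiniteMeasure μ] (U : G → H →L[ℂ] H)
    (hc : ∀ g, Continuous fun a ↦ U a g) (hn : ∀ a g, ‖U a g‖ ≤ ‖g‖) (f : C(G, ℂ)) : H →L[ℂ] H :=
  LinearMap.mkContinuous
    { toFun := fun g ↦ ∫ y, f y • U y g ∂μ
      map_add' := fun g h ↦ by
        simp only [map_add, smul_add]
        exact integral_add
          ((f.continuous.smul (hc g)).integrable_of_hasCompactSupport (.of_compactSpace _))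
          ((f.continuous.smul (hc h)).integrable_of_hasCompactSupport (.of_compactSpace _))
      map_smul' := fun c g ↦ by
        simp only [map_smul, RingHom.id_apply, smul_comm _ c]
        exact integral_smul _ _ }
    (‖f‖ * μ.real Set.univ) (fun g ↦ by
      refine (norm_integral_le_of_norm_le_const (C := ‖f‖ * ‖g‖)
        (.of_forall fun y ↦ ?_)).trans_eq (by ring)
      rw [norm_smul]
      gcongr
      · exact f.norm_coe_le_norm y
      · exact hn y g)

variable (μ : Measure G) [IsFiniteMeasure μ] (U : G → H →L[ℂ] H)
    (hc : ∀ g, Continuous fun a ↦ U a g) (hn : ∀ a g, ‖U a g‖ ≤ ‖g‖)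

theorem smearedOperator_apply (f : C(G, ℂ)) (g : H) :
    smearedOperator μ U hc hn f g = ∫ y, f y • U y g ∂μ := rfl

theorem norm_smearedOperator_le (f : C(G, ℂ)) :
    ‖smearedOperator μ U hc hn f‖ ≤ ‖f‖ * μ.real Set.univ :=
  LinearMap.mkContinuous_norm_le _ (by positivity) _

theorem integrable_smear (hc : ∀ g, Continuous fun a ↦ U a g) (f : C(G, ℂ)) (g : H) :
    Integrable (fun y ↦ f y • U y g) μ :=
  (f.continuous.smul (hc g)).integrable_of_hasCompactSupport (HasCompactSupport.of_compactSpace _)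

theorem smearedOperator_sub (f f' : C(G, ℂ)) :
    smearedOperator μ U hc hn (f - f') =
      smearedOperator μ U hc hn f - smearedOperator μ U hc hn f' := by
  ext g
  simp only [sub_apply, smearedOperator_apply, ContinuousMap.sub_apply, sub_smul]
  exact integral_sub (integrable_smear μ U hc f g) (integrable_smear μ U hc f' g)

theorem continuous_smearedOperator : Continuous (smearedOperator μ U hc hn) := by
  refine (LipschitzWith.of_dist_le_mul (K := (μ.real Set.univ).toNNReal) fun f f' ↦ ?_).continuous
  rw [dist_eq_norm, dist_eq_norm, ← smearedOperator_sub, mul_comm]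
  simpa using! norm_smearedOperator_le μ U hc hn (f - f')

theorem commute_smearedOperator (f : C(G, ℂ)) (S : H →L[ℂ] H) (hS : ∀ y, Commute (U y) S) :
    Commute (smearedOperator μ U hc hn f) S := by
  ext g
  simp only [mul_apply_eq_comp, smearedOperator_apply]
  rw [← ContinuousLinearMap.integral_comp_comm S (integrable_smear μ U hc f g)]
  congr 1
  ext y : 1
  rw [map_smul]
  congr 1
  exact DFunLike.congr_fun (hS y) g

/-- Translating the integration variable moves `U a` onto `f`. Hence `a ↦ U a * T f` is norm
continuous, although `U` itself is only strongly continuous. -/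
theorem mul_smearedOperator [μ.IsAddLeftInvariant] (hadd : ∀ a b, U (a + b) = U a * U b)
    (a : G) (f : C(G, ℂ)) :
    U a * smearedOperator μ U hc hn f =
      smearedOperator μ U hc hn (f.comp ⟨fun y ↦ -a + y, by fun_prop⟩) := by
  ext g
  simp only [mul_apply_eq_comp, smearedOperator_apply]
  rw [← ContinuousLinearMap.integral_comp_comm (U a) (integrable_smear μ U hc f g)]
  refine Eq.trans ?_ (integral_add_left_eq_self _ a)
  congr 1
  ext y : 1
  simp [hadd]

/-- A contraction other than the identity moves the range of some smeared operator. -/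
theorem exists_mul_smearedOperator_ne [T2Space G] [μ.IsOpenPosMeasure] (h0 : U 0 = 1)
    {S : H →L[ℂ] H} (hSn : ∀ g, ‖S g‖ ≤ ‖g‖) (hS : S ≠ 1) :
    ∃ f, S * smearedOperator μ U hc hn f ≠ smearedOperator μ U hc hn f := by
  by_contra! hcon
  obtain ⟨g, hg⟩ : ∃ g, S g ≠ g := by
    by_contra! h
    exact hS (by ext g; simpa using h g)
  have hpos : 0 < ‖S g - g‖ := norm_pos_iff.2 (sub_ne_zero.2 hg)
  -- A third suffices because the final estimate is c‖S g - g‖ ≤ 2εc, where `c` is the integral of a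
  -- bump function at 0.
  set ε := ‖S g - g‖ / 3 with hε
  have hεpos : 0 < ε := by positivity
  have hN : {y | ‖U y g - g‖ < ε} ∈ 𝓝 (0 : G) := by
    have h1 : Continuous fun y ↦ ‖U y g - g‖ := ((hc g).sub continuous_const).norm
    exact (isOpen_lt h1 continuous_const).mem_nhds (by simpa [h0] using hεpos)
  obtain ⟨O, hON, hO, h0O⟩ := mem_nhds_iff.1 hN
  obtain ⟨φ, hφ0, hφ1, hφ⟩ := exists_continuous_zero_one_of_isClosed (isClosed_compl_iff.2 hO)
    (isClosed_singleton (x := (0 : G))) (by simpa using h0O)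
  let f : C(G, ℂ) := ⟨fun y ↦ (φ y : ℂ), by fun_prop⟩
  have hφint : Integrable φ μ :=
    φ.continuous.integrable_of_hasCompactSupport (HasCompactSupport.of_compactSpace _)
  set c := ∫ y, φ y ∂μ with hcdef
  have hcpos : 0 < c := by
    refine φ.continuous.integral_pos_of_hasCompactSupport_nonneg_nonzero
      (HasCompactSupport.of_compactSpace _) (fun y ↦ (hφ y).1) (x := 0) ?_
    have := hφ1 (Set.mem_singleton (0 : G))
    simp [this]
  set T := smearedOperator μ U hc hn f with hT
  have hTg : ‖T g - (c : ℂ) • g‖ ≤ ε * c := by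
    have h1 : T g - (c : ℂ) • g = ∫ y, f y • (U y g - g) ∂μ := by
      simp only [smul_sub]
      rw [integral_sub (integrable_smear μ U hc f g), hT, smearedOperator_apply, integral_smul_const]
      · congr 2
        exact integral_ofReal.symm
      · exact (f.continuous.smul continuous_const).integrable_of_hasCompactSupport
          (HasCompactSupport.of_compactSpace _)
    rw [h1, hcdef, ← integral_const_mul]
    refine norm_integral_le_of_norm_le (hφint.const_mul ε) (.of_forall fun y ↦ ?_)
    rw [norm_smul, mul_comm]
    have hfy : ‖f y‖ = φ y := by simp [f, abs_of_nonneg (hφ y).1]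
    rw [hfy]
    by_cases hy : y ∈ O
    · exact mul_le_mul_of_nonneg_right (hON hy).le (hφ y).1
    · rw [hφ0 hy]; simp
  have hST : S (T g) = T g := DFunLike.congr_fun (hcon f) g
  have h2 : (c : ℂ) • (S g - g) = (T g - (c : ℂ) • g) - S (T g - (c : ℂ) • g) := by
    rw [map_sub, map_smul, hST, smul_sub]; abel
  have h3 : c * ‖S g - g‖ ≤ 2 * (ε * c) := by
    calc c * ‖S g - g‖ = ‖(c : ℂ) • (S g - g)‖ := by
          rw [norm_smul]; simp [abs_of_pos hcpos]
      _ ≤ _ := by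
          rw [h2]
          refine (norm_sub_le _ _).trans ?_
          linarith [hSn (T g - (c : ℂ) • g)]
  nlinarith

end UnitaryRepresentation

/-- Closed commutative star subalgebras of a C⋆-algebra have enough characters. -/
theorem exists_starAlgHom_apply_ne_zero {A : Type*} [CStarAlgebra A] (S : Set A)
    (h1 : ∀ a ∈ S, ∀ b ∈ S, a * b = b * a) (h2 : ∀ a ∈ S, ∀ b ∈ S, a * star b = star b * a)
    (x : (StarAlgebra.adjoin ℂ S).topologicalClosure) (hx : x ≠ 0) :
    ∃ φ : (StarAlgebra.adjoin ℂ S).topologicalClosure →⋆ₐ[ℂ] ℂ, Continuous φ ∧ φ x ≠ 0 := by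
  have hcomm := StarAlgebra.isMulCommutative_adjoin ℂ h1 h2
  have hcl : IsClosed ((StarAlgebra.adjoin ℂ S).topologicalClosure : Set A) :=
    StarSubalgebra.isClosed_topologicalClosure _
  let R := StarSubalgebra.commRingTopologicalClosure (StarAlgebra.adjoin ℂ S)
    (fun x y ↦ hcomm.is_comm.comm x y)
  let _ : CommCStarAlgebra (StarAlgebra.adjoin ℂ S).topologicalClosure :=
    { (inferInstance : CStarAlgebra (StarAlgebra.adjoin ℂ S).topologicalClosure) with
      mul_comm := R.mul_comm }
  by_contra! hcon
  refine hx ((gelfandTransform_isometry (StarAlgebra.adjoin ℂ S).topologicalClosure).injective ?_)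
  rw [map_zero]
  ext φ
  have := hcon (WeakDual.CharacterSpace.equivAlgHom φ |> fun _ ↦
    { WeakDual.CharacterSpace.toAlgHom φ with map_star' := fun a ↦ map_star φ a })
    (map_continuous φ)
  simpa using! this

/-! ### Characters from commuting unitary operators -/

section GelfandCharacters

open MeasureTheory

/-- A strongly continuous unitary representation of a compact Abelian group that is non-trivial
at `a` yields a continuous character that is non-trivial at `a`. -/
theorem exists_continuous_hom_circle_of_unitary {G : Type*} [AddCommGroup G] [TopologicalSpace G]
    [IsTopologicalAddGroup G] [T2Space G] [CompactSpace G] [MeasurableSpace G] [BorelSpace G]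
    {H : Type*} [NormedAddCommGroup H] [InnerProductSpace ℂ H] [CompleteSpace H]
    (μ : Measure G) [IsFiniteMeasure μ] [μ.IsOpenPosMeasure] [μ.IsAddLeftInvariant]
    (U : G → H →L[ℂ] H) (hadd : ∀ a b, U (a + b) = U a * U b) (h0 : U 0 = 1)
    (hc : ∀ g, Continuous fun a ↦ U a g) (hn : ∀ a g, ‖U a g‖ ≤ ‖g‖)
    (hstar : ∀ a, star (U a) = U (-a)) {a : G} (hne : U a ≠ 1) :
    ∃ χ : G → Circle, Continuous χ ∧ (∀ x y, χ (x + y) = χ x * χ y) ∧ χ a ≠ 1 := by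
  have hUU : ∀ a b, Commute (U a) (U b) := fun a b ↦ by
    rw [Commute, SemiconjBy, ← hadd, ← hadd, add_comm]
  obtain ⟨f, hf⟩ := exists_mul_smearedOperator_ne μ U hc hn h0 (hn a) hne
  let T := smearedOperator μ U hc hn
  let S : Set (H →L[ℂ] H) := Set.range U ∪ Set.range T
  have hTU : ∀ f b, Commute (T f) (U b) := fun f b ↦
    commute_smearedOperator μ U hc hn f _ fun y ↦ hUU y b
  have hTT : ∀ f f', Commute (T f) (T f') := fun f f' ↦
    commute_smearedOperator μ U hc hn f _ fun y ↦ (hTU f' y).symm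
  have hTUs : ∀ f b, Commute (U b) (star (T f)) := fun f b ↦ by
    have := (hTU f (-b)).star_star.symm
    rwa [hstar, neg_neg] at this
  have hS1 : ∀ x ∈ S, ∀ y ∈ S, x * y = y * x := by
    rintro _ (⟨b, rfl⟩ | ⟨b, rfl⟩) _ (⟨c, rfl⟩ | ⟨c, rfl⟩)
    · exact hUU b c
    · exact (hTU c b).symm
    · exact hTU b c
    · exact hTT b c
  have hS2 : ∀ x ∈ S, ∀ y ∈ S, x * star y = star y * x := by
    rintro _ (⟨b, rfl⟩ | ⟨b, rfl⟩) _ (⟨c, rfl⟩ | ⟨c, rfl⟩)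
    · rw [hstar]; exact hUU b _
    · exact hTUs c b
    · rw [hstar]; exact hTU b _
    · exact commute_smearedOperator μ U hc hn b _ fun y ↦ hTUs c y
  let A := (StarAlgebra.adjoin ℂ S).topologicalClosure
  have hSA : S ⊆ A := (StarAlgebra.subset_adjoin ℂ S).trans
    (StarSubalgebra.le_topologicalClosure _)
  let u : G → A := fun b ↦ ⟨U b, hSA (.inl ⟨b, rfl⟩)⟩
  let t : C(G, ℂ) → A := fun f ↦ ⟨T f, hSA (.inr ⟨f, rfl⟩)⟩
  have hx : u a * t f - t f ≠ 0 := by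
    intro h
    exact hf (congrArg Subtype.val (sub_eq_zero.1 h))
  obtain ⟨φ, hφc, hφ⟩ := exists_starAlgHom_apply_ne_zero S hS1 hS2 _ hx
  -- Both factors matter: the first makes the character non-trivial at `a`, the second can be
  -- divided by to prove continuity.
  have hφ' : (φ (u a) - 1) * φ (t f) ≠ 0 := by
    convert! hφ using 1
    rw [map_sub, map_mul]; ring
  have hu_add : ∀ b c, φ (u (b + c)) = φ (u b) * φ (u c) := fun b c ↦ by
    rw [← map_mul]
    congr 1
    exact Subtype.ext (hadd b c)
  have hu_norm : ∀ b, ‖φ (u b)‖ = 1 := by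
    intro b
    have h1 : star (φ (u b)) * φ (u b) = 1 := by
      rw [← map_star, ← map_mul, ← map_one φ]
      congr 1
      refine Subtype.ext ?_
      change star (U b) * U b = 1
      rw [hstar, ← hadd]; simp [h0]
    have h2 : ‖φ (u b)‖ * ‖φ (u b)‖ = 1 := by
      rw [← CStarRing.norm_star_mul_self, h1, norm_one]
    nlinarith [norm_nonneg (φ (u b))]
  have hu_cont : Continuous fun b ↦ φ (u b) := by
    have h1 : ∀ b, φ (u b) = φ (u b * t f) / φ (t f) := fun b ↦ by
      rw [map_mul, mul_div_cancel_right₀ _ (right_ne_zero_of_mul hφ')]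
    simp_rw [h1]
    refine (hφc.comp ?_).div_const _
    refine Continuous.subtype_mk (f := fun b ↦ U b * T f) ?_ _
    simp_rw [T, mul_smearedOperator μ U hc hn hadd]
    refine (continuous_smearedOperator μ U hc hn).comp ?_
    let F : C(G, C(G, ℂ)) := ContinuousMap.curry ⟨fun p : G × G ↦ f (-p.1 + p.2), by fun_prop⟩
    exact F.continuous
  refine ⟨fun b ↦ ⟨φ (u b), mem_sphere_zero_iff_norm.2 (hu_norm b)⟩, hu_cont.subtype_mk _,
    fun x y ↦ Circle.ext (hu_add x y), fun h ↦ left_ne_zero_of_mul hφ' ?_⟩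
  rw [sub_eq_zero]
  exact congrArg Subtype.val h

end GelfandCharacters

/-! ### The regular representation on L² -/

section LTwo

open MeasureTheory

variable {G : Type*} [AddCommGroup G] [TopologicalSpace G] [IsTopologicalAddGroup G]
  [T2Space G] [CompactSpace G]

/-- Translation by `a` on `L²`. -/
noncomputable def translationLTwo [MeasurableSpace G] [BorelSpace G] (μ : Measure G)
    [μ.IsAddLeftInvariant] (a : G) : Lp ℂ 2 μ →L[ℂ] Lp ℂ 2 μ :=
  (Lp.compMeasurePreservingₗᵢ ℂ (fun x ↦ a + x)
    (measurePreserving_add_left μ a)).toContinuousLinearMap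

/-- The regular representation is faithful: translation by `a` moves a Urysohn function separating
`a` from 0, and since Haar measure has full support this is visible in L². -/
theorem exists_continuous_hom_circle_ne_one {a : G} (ha : a ≠ 0) :
    ∃ χ : G → Circle, Continuous χ ∧ (∀ x y, χ (x + y) = χ x * χ y) ∧ χ a ≠ 1 := by
  let _ : MeasurableSpace G := borel G
  have _ : BorelSpace G := ⟨rfl⟩
  let μ : Measure G := Measure.addHaarMeasure ⊤
  let U : G → Lp ℂ 2 μ →L[ℂ] Lp ℂ 2 μ := translationLTwo μ
  have hadd : ∀ a b, U (a + b) = U a * U b := by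
    intro a b
    ext1 g
    have := Lp.compMeasurePreserving_comp_apply g (measurePreserving_add_left μ b)
      (measurePreserving_add_left μ a)
    simp only [mul_apply_eq_comp]
    refine Eq.trans ?_ this
    change Lp.compMeasurePreserving _ _ g = _
    congr 1
    congr 1
    ext x
    simp only [Function.comp]
    abel
  have h0 : U 0 = 1 := by
    ext1 g
    refine Eq.trans ?_ (Lp.compMeasurePreserving_id_apply g)
    change Lp.compMeasurePreserving _ _ g = _
    congr 1
    congr 1
    ext x
    simp
  have hnorm : ∀ a g, ‖U a g‖ = ‖g‖ := fun a g ↦ LinearIsometry.norm_map _ _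
  have hn : ∀ a g, ‖U a g‖ ≤ ‖g‖ := fun a g ↦ (hnorm a g).le
  have hc : ∀ g, Continuous fun a ↦ U a g := by
    intro g
    let F : G → C(G, G) := ContinuousMap.curry ⟨fun p : G × G ↦ p.1 + p.2, by fun_prop⟩
    have hF : Continuous F := ContinuousMap.continuous _
    exact (continuous_const (y := g)).compMeasurePreservingLp hF
      (fun a ↦ measurePreserving_add_left μ a) (by simp)
  have hstar : ∀ a, star (U a) = U (-a) := by
    intro a
    have h1 : star (U a) * U a = 1 := by
      rw [ContinuousLinearMap.star_eq_adjoint]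
      exact (ContinuousLinearMap.norm_map_iff_adjoint_comp_self (U a)).1 (hnorm a)
    have h2 : U a * U (-a) = 1 := by rw [← hadd]; simp [h0]
    exact left_inv_eq_right_inv h1 h2
  have hne : U a ≠ 1 := by
    intro h
    obtain ⟨f, hf0, hf1, -⟩ := exists_continuous_zero_one_of_isClosed
      (isClosed_singleton (x := a)) (isClosed_singleton (x := (0 : G))) (by simpa using ha)
    let F : C(G, ℂ) := ⟨fun y ↦ (f y : ℂ), by fun_prop⟩
    have h1 : ContinuousMap.toLp 2 μ ℂ (F.comp ⟨fun x ↦ a + x, by fun_prop⟩) =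
        ContinuousMap.toLp 2 μ ℂ F := by
      have h2 : U a (ContinuousMap.toLp 2 μ ℂ F) = ContinuousMap.toLp 2 μ ℂ F := by rw [h]; rfl
      rw [← h2]
      rfl
    have h3 := DFunLike.congr_fun (ContinuousMap.toLp_injective μ h1) 0
    have h4 : f a = f 0 := by simpa [F] using h3
    rw [hf0 rfl, hf1 rfl] at h4
    simp at h4
  exact exists_continuous_hom_circle_of_unitary μ U hadd h0 hc hn hstar hne

end LTwo

/-! ### The dual group and annihilators -/

/-- The group of continuous characters. -/
abbrev DualGroup (G : Type*) [AddCommGroup G] [TopologicalSpace G] := G →ₜ+ UnitAddCircle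

section Annihilator

variable {G : Type*} [AddCommGroup G] [TopologicalSpace G]

/-- The subgroup of points at which all characters in `A` vanish. -/
def annihilator (A : Set (DualGroup G)) : AddSubgroup G where
  carrier := {x | ∀ χ ∈ A, χ x = 0}
  zero_mem' := fun χ _ ↦ map_zero χ
  add_mem' := fun {x y} hx hy χ hχ ↦ by rw [map_add, hx χ hχ, hy χ hχ, add_zero]
  neg_mem' := fun {x} hx χ hχ ↦ by rw [map_neg, hx χ hχ, neg_zero]

theorem mem_annihilator {A : Set (DualGroup G)} {x : G} :
    x ∈ annihilator A ↔ ∀ χ ∈ A, χ x = 0 := Iff.rfl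

theorem isClosed_annihilator (A : Set (DualGroup G)) : IsClosed (annihilator A : Set G) := by
  have : (annihilator A : Set G) = ⋂ χ ∈ A, {x | χ x = 0} := by
    ext x; simp [mem_annihilator]
  rw [this]
  exact isClosed_biInter fun χ _ ↦ isClosed_eq (map_continuous χ) continuous_const

theorem annihilator_anti {A B : Set (DualGroup G)} (h : A ⊆ B) : annihilator B ≤ annihilator A :=
  fun _ hx χ hχ ↦ hx χ (h hχ)

theorem apply_eq_zero_of_mem_closure {A : Set (DualGroup G)} {χ : DualGroup G}
    (hχ : χ ∈ AddSubgroup.closure A) {x : G} (hx : x ∈ annihilator A) : χ x = 0 := by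
  induction hχ using AddSubgroup.closure_induction with
  | mem χ h => exact hx χ h
  | zero => rfl
  | add χ ψ _ _ h1 h2 => rw [ContinuousAddMonoidHom.add_apply, h1, h2, add_zero]
  | neg χ _ h => rw [show (-χ) x = -(χ x) from rfl, h, neg_zero]

end Annihilator

/-! ### Separation by characters -/

section Separation

variable {G : Type*} [AddCommGroup G] [TopologicalSpace G] [IsTopologicalAddGroup G]
  [T2Space G] [CompactSpace G]

theorem exists_character_ne_zero {a : G} (ha : a ≠ 0) : ∃ χ : DualGroup G, χ a ≠ 0 := by
  obtain ⟨χ, hc, hadd, hne⟩ := exists_continuous_hom_circle_ne_one ha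
  let e := AddCircle.homeomorphCircle (T := (1 : ℝ)) one_ne_zero
  have he : ∀ x y, e (x + y) = e x * e y := fun x y ↦ by
    simp only [e, AddCircle.homeomorphCircle_apply, AddCircle.toCircle_add]
  have h0 : e 0 = 1 := by simp [e, AddCircle.homeomorphCircle_apply]
  refine ⟨⟨AddMonoidHom.mk' (fun x ↦ e.symm (χ x)) fun x y ↦ ?_, ?_⟩, fun h ↦ hne ?_⟩
  · apply e.injective
    simp [he, hadd]
  · exact e.symm.continuous.comp hc
  · have h1 : e.symm (χ a) = 0 := h
    rw [e.symm_apply_eq, h0] at h1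
    exact h1

/-- Characters separate points from closed subgroups. -/
theorem exists_character_of_notMem {G : Type*} [AddCommGroup G] [TopologicalSpace G]
    [IsTopologicalAddGroup G] [CompactSpace G] {M : AddSubgroup G} (hM : IsClosed (M : Set G))
    {a : G} (ha : a ∉ M) : ∃ χ : DualGroup G, (∀ x ∈ M, χ x = 0) ∧ χ a ≠ 0 := by
  -- As an instance, closedness makes the quotient Hausdorff.
  have : IsClosed (M : Set G) := hM
  have ha' : (a : G ⧸ M) ≠ 0 := fun h ↦ ha ((QuotientAddGroup.eq_zero_iff a).1 h)
  obtain ⟨χ, hχ⟩ := exists_character_ne_zero ha'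
  refine ⟨χ.comp ⟨QuotientAddGroup.mk' M, continuous_quotient_mk'⟩, fun x hx ↦ ?_, hχ⟩
  change χ (x : G ⧸ M) = 0
  rw [(QuotientAddGroup.eq_zero_iff x).2 hx, map_zero]

/-- The kernels of all characters meet only in 0, so by compactness finitely many of them already
miss the complement of an open neighbourhood. -/
theorem exists_finset_annihilator_subset {U : Set G} (hU : U ∈ 𝓝 (0 : G)) :
    ∃ F : Finset (DualGroup G), (annihilator (F : Set (DualGroup G)) : Set G) ⊆ U := by
  obtain ⟨O, hOU, hO, h0⟩ := mem_nhds_iff.1 hU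
  obtain ⟨F, hF⟩ := hO.isClosed_compl.isCompact.elim_finite_subfamily_closed
    (fun χ : DualGroup G ↦ {x | χ x = 0})
    (fun χ ↦ isClosed_eq (map_continuous χ) continuous_const) (by
      rw [Set.eq_empty_iff_forall_notMem]
      rintro x ⟨hx, hx'⟩
      refine hx ?_
      by_contra hxO
      have : x ≠ 0 := fun h ↦ hxO (h ▸ h0)
      obtain ⟨χ, hχ⟩ := exists_character_ne_zero this
      exact hχ (Set.mem_iInter.1 hx' χ))
  refine ⟨F, fun x hx ↦ hOU ?_⟩
  by_contra hxO
  have : x ∈ Oᶜ ∩ ⋂ i ∈ F, {x | i x = 0} := ⟨hxO, by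
    simp only [Set.mem_iInter]; exact fun χ hχ ↦ hx χ hχ⟩
  rw [hF] at this
  exact this

end Separation

/-! ### Orthogonality of characters and the double annihilator -/

section Orthogonality

open MeasureTheory

variable {G : Type*} [AddCommGroup G] [TopologicalSpace G]

/-- A character as a complex-valued continuous function. -/
noncomputable def DualGroup.toComplex (χ : DualGroup G) : C(G, ℂ) :=
  ⟨fun x ↦ (AddCircle.toCircle (χ x) : ℂ),
    continuous_subtype_val.comp (AddCircle.continuous_toCircle.comp (map_continuous χ))⟩

theorem DualGroup.toComplex_apply (χ : DualGroup G) (x : G) :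
    χ.toComplex x = (AddCircle.toCircle (χ x) : ℂ) := rfl

theorem DualGroup.toComplex_map_add (χ : DualGroup G) (x y : G) :
    χ.toComplex (x + y) = χ.toComplex x * χ.toComplex y := by
  simp [DualGroup.toComplex_apply, AddCircle.toCircle_add]

theorem DualGroup.toComplex_add (χ ψ : DualGroup G) :
    (χ + ψ).toComplex = χ.toComplex * ψ.toComplex := by
  ext x
  simp [DualGroup.toComplex_apply, AddCircle.toCircle_add, ContinuousAddMonoidHom.add_apply]

theorem DualGroup.toComplex_zero : (0 : DualGroup G).toComplex = 1 := by
  ext x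
  change (AddCircle.toCircle (0 : UnitAddCircle) : ℂ) = 1
  simp

theorem DualGroup.toComplex_neg (χ : DualGroup G) : (-χ).toComplex = star χ.toComplex := by
  ext x
  change (AddCircle.toCircle (-(χ x)) : ℂ) = star (AddCircle.toCircle (χ x) : ℂ)
  rw [AddCircle.toCircle_neg, Circle.coe_inv_eq_conj]
  rfl

theorem DualGroup.toComplex_apply_eq_one {χ : DualGroup G} {x : G} :
    χ.toComplex x = 1 ↔ χ x = 0 := by
  rw [toComplex_apply, ← Circle.coe_one, Circle.coe_inj,
    ← AddCircle.toCircle_zero (T := (1 : ℝ)),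
    (AddCircle.injective_toCircle (T := (1 : ℝ)) one_ne_zero).eq_iff]

theorem integral_toComplex_eq_zero [IsTopologicalAddGroup G] [MeasurableSpace G] [BorelSpace G]
    (μ : Measure G) [μ.IsAddLeftInvariant] {χ : DualGroup G} (hχ : χ ≠ 0) :
    ∫ x, χ.toComplex x ∂μ = 0 := by
  obtain ⟨a, ha⟩ : ∃ a, χ a ≠ 0 := by
    by_contra! h
    exact hχ (ContinuousAddMonoidHom.ext h)
  have h := integral_add_left_eq_self (μ := μ) (fun x ↦ χ.toComplex x) a
  simp only [DualGroup.toComplex_map_add, integral_const_mul] at h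
  have h' : (χ.toComplex a - 1) * ∫ x, χ.toComplex x ∂μ = 0 := by
    rw [sub_mul, h]; ring
  refine (mul_eq_zero.1 h').resolve_left fun h1 ↦ ha ?_
  exact DualGroup.toComplex_apply_eq_one.1 (sub_eq_zero.1 h1)

variable [IsTopologicalAddGroup G] [CompactSpace G]

/-- A point-separating subgroup of the dual of a compact group is the whole dual. -/
theorem eq_top_of_annihilator_eq_bot [T2Space G] {B : AddSubgroup (DualGroup G)}
    (hB : annihilator (B : Set (DualGroup G)) = ⊥) : B = ⊤ := by
  let _ : MeasurableSpace G := borel G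
  have _ : BorelSpace G := ⟨rfl⟩
  let μ : Measure G := Measure.addHaarMeasure ⊤
  let P : Submodule ℂ C(G, ℂ) := Submodule.span ℂ (DualGroup.toComplex '' (B : Set (DualGroup G)))
  have hmul : ∀ f g, f ∈ P → g ∈ P → f * g ∈ P := by
    intro f g hf hg
    induction hf, hg using Submodule.span_induction₂ with
    | mem_mem f g hf hg =>
      obtain ⟨χ, hχ, rfl⟩ := hf
      obtain ⟨ψ, hψ, rfl⟩ := hg
      rw [← DualGroup.toComplex_add]
      exact Submodule.subset_span ⟨_, B.add_mem hχ hψ, rfl⟩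
    | zero_left => simp
    | zero_right => simp
    | add_left x y z _ _ _ h1 h2 => rw [add_mul]; exact P.add_mem h1 h2
    | add_right x y z _ _ _ h1 h2 => rw [mul_add]; exact P.add_mem h1 h2
    | smul_left r x y _ _ h => rw [smul_mul_assoc]; exact P.smul_mem r h
    | smul_right r x y _ _ h => rw [mul_smul_comm]; exact P.smul_mem r h
  have hone : (1 : C(G, ℂ)) ∈ P :=
    Submodule.subset_span ⟨0, B.zero_mem, DualGroup.toComplex_zero⟩
  have hstar : ∀ f ∈ P, star f ∈ P := by
    intro f hf
    induction hf using Submodule.span_induction with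
    | mem f hf =>
      obtain ⟨χ, hχ, rfl⟩ := hf
      rw [← DualGroup.toComplex_neg]
      exact Submodule.subset_span ⟨_, B.neg_mem hχ, rfl⟩
    | zero => simp
    | add x y _ _ h1 h2 => rw [star_add]; exact P.add_mem h1 h2
    | smul r x _ h => rw [star_smul]; exact P.smul_mem _ h
  let A : StarSubalgebra ℂ C(G, ℂ) :=
    { P.toSubalgebra hone hmul with star_mem' := fun {f} hf ↦ hstar f hf }
  have hA : A.topologicalClosure = ⊤ := by
    refine ContinuousMap.starSubalgebra_topologicalClosure_eq_top_of_separatesPoints A ?_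
    intro x y hxy
    obtain ⟨χ, hχ, hne⟩ : ∃ χ ∈ B, χ (x - y) ≠ 0 := by
      by_contra! h
      have : x - y ∈ annihilator (B : Set (DualGroup G)) := h
      rw [hB, AddSubgroup.mem_bot, sub_eq_zero] at this
      exact hxy this
    refine ⟨χ.toComplex, ⟨χ.toComplex, Submodule.subset_span ⟨χ, hχ, rfl⟩, rfl⟩, fun h ↦ hne ?_⟩
    simp only [DualGroup.toComplex_apply, Circle.coe_inj] at h
    rw [map_sub, sub_eq_zero]
    exact AddCircle.injective_toCircle (T := (1 : ℝ)) one_ne_zero h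
  rw [eq_top_iff]
  rintro χ -
  by_contra hχ
  have hint : ∀ f : C(G, ℂ), Integrable f μ := fun f ↦
    f.continuous.integrable_of_hasCompactSupport (HasCompactSupport.of_compactSpace _)
  -- A character outside `B` is orthogonal to every member of `B`, hence to their span, which is
  -- uniformly dense by Stone–Weierstrass.
  have horth : ∀ f ∈ P, ∫ x, (f * (-χ).toComplex) x ∂μ = 0 := by
    intro f hf
    induction hf using Submodule.span_induction with
    | mem f hf =>
      obtain ⟨ψ, hψ, rfl⟩ := hf
      rw [← DualGroup.toComplex_add]
      refine integral_toComplex_eq_zero μ fun h ↦ hχ ?_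
      rw [← sub_eq_add_neg, sub_eq_zero] at h
      exact h ▸ hψ
    | zero => simp
    | add x y _ _ h1 h2 =>
      rw [add_mul]
      simp only [ContinuousMap.add_apply]
      rw [integral_add (hint _) (hint _), h1, h2, add_zero]
    | smul r x _ h =>
      rw [smul_mul_assoc]
      simp only [ContinuousMap.smul_apply]
      rw [integral_smul, h, smul_zero]
  have hmem : χ.toComplex ∈ closure (A : Set C(G, ℂ)) := by
    have : χ.toComplex ∈ A.topologicalClosure := by rw [hA]; trivial
    exact this
  obtain ⟨f, hf, hfd⟩ := Metric.mem_closure_iff.1 hmem (1 / 2) (by norm_num)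
  -- For `f` in the span within 1/2 of χ, this integral is the full mass by orthogonality, but at
  -- most half of it by the estimate.
  have h1 : ∫ x, ((χ.toComplex - f) * (-χ).toComplex) x ∂μ = μ.real Set.univ := by
    rw [sub_mul]
    simp only [ContinuousMap.sub_apply]
    rw [integral_sub (hint _) (hint _), horth f hf, ← DualGroup.toComplex_add, add_neg_cancel,
      DualGroup.toComplex_zero]
    simp
  have h2 : ‖∫ x, ((χ.toComplex - f) * (-χ).toComplex) x ∂μ‖ ≤ 1 / 2 * μ.real Set.univ := by
    refine norm_integral_le_of_norm_le_const (.of_forall fun x ↦ ?_)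
    rw [ContinuousMap.mul_apply, norm_mul, DualGroup.toComplex_apply, Circle.norm_coe, mul_one]
    rw [dist_eq_norm] at hfd
    exact ((χ.toComplex - f).norm_coe_le_norm x).trans hfd.le
  have h3 : 0 < μ.real Set.univ := by
    rw [measureReal_def, ENNReal.toReal_pos_iff]
    exact ⟨isOpen_univ.measure_pos μ Set.univ_nonempty, measure_lt_top μ _⟩
  rw [h1, Complex.norm_real, Real.norm_of_nonneg h3.le] at h2
  linarith

/-- The characters in `A` descend to the quotient by their annihilator, where they separate points
and so generate the whole dual. -/
theorem mem_closure_of_vanishes_on_annihilator {A : Set (DualGroup G)}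
    {χ : DualGroup G} (hχ : ∀ x ∈ annihilator A, χ x = 0) : χ ∈ AddSubgroup.closure A := by
  let N := annihilator A
  have hN : IsClosed (N : Set G) := isClosed_annihilator A
  let π : G →ₜ+ G ⧸ N := ⟨QuotientAddGroup.mk' N, continuous_quotient_mk'⟩
  have hlift : ∀ χ : DualGroup G, (∀ x ∈ N, χ x = 0) → ∃ ψ : DualGroup (G ⧸ N), ψ.comp π = χ := by
    intro χ hχ
    refine ⟨⟨QuotientAddGroup.lift N χ.toAddMonoidHom hχ, ?_⟩, ?_⟩
    · exact continuous_quot_lift _ (map_continuous χ)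
    · ext x
      rfl
  let B : AddSubgroup (DualGroup (G ⧸ N)) :=
    { carrier := {ψ | ψ.comp π ∈ AddSubgroup.closure A}
      zero_mem' := (AddSubgroup.closure A).zero_mem
      add_mem' := fun h1 h2 ↦ (AddSubgroup.closure A).add_mem h1 h2
      neg_mem' := fun h ↦ (AddSubgroup.closure A).neg_mem h }
  have hB : B = ⊤ := by
    refine eq_top_of_annihilator_eq_bot ?_
    rw [eq_bot_iff]
    intro y hy
    obtain ⟨x, rfl⟩ := QuotientAddGroup.mk_surjective y
    rw [AddSubgroup.mem_bot, QuotientAddGroup.eq_zero_iff]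
    intro χ hχ
    obtain ⟨ψ, hψ⟩ := hlift χ fun z hz ↦ hz χ hχ
    have : ψ (π x) = 0 := hy ψ (show ψ ∈ B by
      change ψ.comp π ∈ AddSubgroup.closure A
      rw [hψ]; exact AddSubgroup.subset_closure hχ)
    rw [← hψ]
    exact this
  obtain ⟨ψ, rfl⟩ := hlift χ hχ
  have : ψ ∈ B := hB ▸ AddSubgroup.mem_top ψ
  exact this

end Orthogonality

/-! ### Weight -/

section Weight

open Cardinal

theorem exists_isTopologicalBasis_mk_eq_weight (X : Type u) [TopologicalSpace X] :
    ∃ B : Set (Set X), IsTopologicalBasis B ∧ #B = weight X :=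
  csInf_mem (s := {κ : Cardinal.{u} | ∃ B : Set (Set X), IsTopologicalBasis B ∧ #B = κ})
    ⟨_, _, isTopologicalBasis_opens, rfl⟩

theorem weight_le_mk {X : Type u} [TopologicalSpace X] {B : Set (Set X)}
    (hB : IsTopologicalBasis B) : weight X ≤ #B :=
  csInf_le' ⟨B, hB, rfl⟩

theorem Topology.IsInducing.weight_le {X Y : Type u} [TopologicalSpace X] [TopologicalSpace Y]
    {f : X → Y} (hf : IsInducing f) : weight X ≤ weight Y := by
  obtain ⟨B, hB, hBw⟩ := exists_isTopologicalBasis_mk_eq_weight Y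
  rw [← hBw]
  exact (weight_le_mk (hB.isInducing hf)).trans mk_image_le

/-- A nontrivial connected Hausdorff space has infinite weight. -/
theorem aleph0_le_weight (X : Type u) [TopologicalSpace X] [T1Space X] [PreconnectedSpace X]
    [Nontrivial X] : ℵ₀ ≤ weight X := by
  obtain ⟨B, hB, hBw⟩ := exists_isTopologicalBasis_mk_eq_weight X
  rw [← hBw]
  by_contra! h
  have hfin : Finite B := Cardinal.lt_aleph0_iff_finite.1 h
  have hinj : Function.Injective fun x : X ↦ {b : B | x ∈ (b : Set X)} := by
    intro x y hxy
    refine hB.eq_iff.2 fun s hs ↦ ?_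
    exact Set.ext_iff.1 hxy ⟨s, hs⟩
  have : Finite X := Finite.of_injective _ hinj
  exact not_subsingleton X PreconnectedSpace.trivial_of_discrete

/-- By compactness the `f i` embed `X` in a power of `Y`, so preimages of a countable base form a
subbase of size at most κ; finite intersections are indexed by lists. -/
theorem weight_le_of_separating {X : Type u} {Y : Type*} [TopologicalSpace X] [CompactSpace X]
    [TopologicalSpace Y] [T2Space Y] [SecondCountableTopology Y] {ι : Type u} (f : ι → X → Y)
    (hf : ∀ i, Continuous (f i)) (hsep : ∀ x y, (∀ i, f i x = f i y) → x = y)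
    {κ : Cardinal.{u}} (hκ : ℵ₀ ≤ κ) (hι : #ι ≤ κ) : weight X ≤ κ := by
  have hF : IsInducing fun x i ↦ f i x :=
    ((continuous_pi hf).isClosedEmbedding fun x y h ↦ hsep x y fun i ↦ congrFun h i).isInducing
  let s : Set (Set X) := ⋃ i, Set.preimage (f i) '' countableBasis Y
  have hs : (‹TopologicalSpace X›) = generateFrom s := by
    rw [hF.eq_induced, Pi.topologicalSpace, induced_iInf]
    rw [generateFrom_iUnion]
    congr 1
    ext1 i
    rw [induced_compose, ← induced_generateFrom_eq,
      ← (isBasis_countableBasis Y).eq_generateFrom]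
    rfl
  refine (weight_le_mk (isTopologicalBasis_of_subbasis hs)).trans ?_
  have hscard : #s ≤ κ := by
    refine (mk_iUnion_le _).trans (mul_le_of_le hκ hι (ciSup_le' fun i ↦ ?_))
    exact (((countable_countableBasis Y).image _).le_aleph0).trans hκ
  have hsub : ((fun f ↦ ⋂₀ f) '' {f : Set (Set X) | f.Finite ∧ f ⊆ s}) ⊆
      Set.range fun l : List s ↦ ⋂₀ {t | ∃ h : t ∈ s, (⟨t, h⟩ : s) ∈ l} := by
    rintro _ ⟨F, ⟨hF, hFs⟩, rfl⟩
    obtain ⟨l, hl⟩ : ∃ l : List s, ∀ t : s, t ∈ l ↔ (t : Set X) ∈ F := by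
      have hfin : {t : s | (t : Set X) ∈ F}.Finite :=
        hF.preimage Subtype.val_injective.injOn
      exact ⟨hfin.toFinset.toList, fun t ↦ by simp⟩
    refine ⟨l, congrArg Set.sInter (Set.ext fun t ↦ ?_)⟩
    exact ⟨fun ⟨h, h'⟩ ↦ (hl ⟨t, h⟩).1 h', fun h ↦ ⟨hFs h, (hl ⟨t, _⟩).2 h⟩⟩
  calc _ ≤ _ := mk_le_mk_of_subset hsub
    _ ≤ #(List s) := mk_range_le
    _ ≤ max ℵ₀ #s := mk_list_le_max _
    _ ≤ κ := max_le hκ hscard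

open scoped Pointwise in
theorem mk_addSubgroup_closure_le {X : Type u} [AddCommGroup X] {A : Set X} {κ : Cardinal.{u}}
    (hκ : ℵ₀ ≤ κ) (hA : #A ≤ κ) : #(AddSubgroup.closure A) ≤ κ := by
  have hsub : (AddSubgroup.closure A : Set X) ⊆
      Set.range fun l : List ↥(A ∪ -A) ↦ (l.map Subtype.val).sum := by
    intro x hx
    rw [SetLike.mem_coe, ← AddSubgroup.mem_toAddSubmonoid,
      AddSubgroup.closure_toAddSubmonoid] at hx
    obtain ⟨l, hl, rfl⟩ := AddSubmonoid.exists_list_of_mem_closure hx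
    exact ⟨l.attach.map fun y ↦ ⟨y.1, hl y.1 y.2⟩, by simp [List.map_map, Function.comp_def]⟩
  calc _ ≤ _ := mk_le_mk_of_subset hsub
    _ ≤ _ := mk_range_le
    _ ≤ _ := mk_list_le_max _
    _ ≤ κ := max_le hκ ((mk_union_le _ _).trans
      (add_le_of_le hκ hA (by rwa [mk_neg])))

end Weight

/-! ### Torsion characters and connectedness -/

section Torsion

/-- A character that is torsion on a connected set through the origin vanishes there. -/
theorem IsPreconnected.character_eq_zero {G : Type*} [AddCommGroup G] [TopologicalSpace G]
    {t : Set G} (ht : IsPreconnected t) (h0 : 0 ∈ t) (χ : DualGroup G) {n : ℕ} (hn : 0 < n)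
    (h : ∀ x ∈ t, n • χ x = 0) {x : G} (hx : x ∈ t) : χ x = 0 := by
  have h1 : IsPreconnected (χ '' t) := ht.image _ (map_continuous χ).continuousOn
  have h2 : (χ '' t).Finite := (AddCircle.finite_torsion 1 hn).subset (by
    rintro _ ⟨y, hy, rfl⟩; exact h y hy)
  by_contra hne
  refine h1.infinite_of_nontrivial ⟨χ x, ⟨x, hx, rfl⟩, 0, ⟨0, h0, map_zero χ⟩, hne⟩ h2

/-- Characters of compact totally disconnected groups are torsion. -/
theorem exists_nsmul_eq_zero_of_totallyDisconnected {Q : Type*} [AddCommGroup Q]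
    [TopologicalSpace Q] [IsTopologicalAddGroup Q] [T2Space Q] [CompactSpace Q]
    [TotallyDisconnectedSpace Q] (χ : DualGroup Q) :
    ∃ n : ℕ, 0 < n ∧ ∀ x, n • χ x = 0 := by
  -- The circle has no small subgroups: an element all of whose powers stay in this arc is 1. So an
  -- open subgroup inside `N` is killed by χ, and its index is the required exponent.
  let N : Set Q := {x | AddCircle.toCircle (χ x) ∈ Circle.centeredArc (Real.pi / 2)}
  have hN : IsOpen N := (Circle.isOpen_centeredArc _).preimage
    (AddCircle.continuous_toCircle.comp (map_continuous χ))
  have h0 : (0 : Q) ∈ N := by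
    simp only [N, Set.mem_ofPred_eq, map_zero, AddCircle.toCircle_zero]
    exact ⟨0, by simp [Real.pi_pos], by simp⟩
  obtain ⟨W, hW, h0W, hWN⟩ := compact_exists_isClopen_in_isOpen hN h0
  obtain ⟨H, hH⟩ := IsTopologicalAddGroup.exist_openAddSubgroup_sub_clopen_nhds_of_zero hW h0W
  have hχ : ∀ x ∈ H, χ x = 0 := by
    intro x hx
    have : AddCircle.toCircle (χ x) = 1 := by
      refine Circle.eq_one_of_forall_pow_mem_centeredArc_pi_div_two fun n _ ↦ ?_
      rw [← AddCircle.toCircle_nsmul, ← map_nsmul]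
      exact hWN (hH (H.toAddSubgroup.nsmul_mem hx n))
    rw [← AddCircle.toCircle_zero (T := (1 : ℝ))] at this
    exact AddCircle.injective_toCircle one_ne_zero this
  have hfin : Finite (Q ⧸ H.toAddSubgroup) :=
    AddSubgroup.quotient_finite_of_isOpen _ H.isOpen
  have : H.toAddSubgroup.FiniteIndex := AddSubgroup.finiteIndex_of_finite_quotient
  refine ⟨H.toAddSubgroup.index, Nat.pos_of_ne_zero AddSubgroup.FiniteIndex.index_ne_zero,
    fun x ↦ ?_⟩
  rw [← map_nsmul]
  exact hχ _ (H.toAddSubgroup.nsmul_index_mem x)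

open Cardinal in
/-- The weight of a compact connected group is bounded by the number of characters needed to
cut out a totally disconnected subgroup. -/
theorem weight_le_of_totallyDisconnected_annihilator {C : Type u} [AddCommGroup C]
    [TopologicalSpace C] [IsTopologicalAddGroup C] [T2Space C] [CompactSpace C] [ConnectedSpace C]
    (A : Set (DualGroup C)) (hQ : TotallyDisconnectedSpace (annihilator A)) {κ : Cardinal.{u}}
    (hκ : ℵ₀ ≤ κ) (hA : #A ≤ κ) : weight C ≤ κ := by
  have : CompactSpace (annihilator A) :=
    isCompact_iff_compactSpace.1 (isClosed_annihilator A).isCompact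
  have h1 : ∀ χ : DualGroup C, ∃ n : ℕ, 0 < n ∧ n • χ ∈ AddSubgroup.closure A := by
    intro χ
    obtain ⟨n, hn, h⟩ := exists_nsmul_eq_zero_of_totallyDisconnected
      (χ.comp ⟨(annihilator A).subtype, continuous_subtype_val⟩)
    refine ⟨n, hn, mem_closure_of_vanishes_on_annihilator fun x hx ↦ ?_⟩
    rw [ContinuousAddMonoidHom.nsmul_apply]
    exact h ⟨x, hx⟩
  choose n hn hmem using h1
  -- If nχ = nψ, then χ - ψ is torsion on a connected group, hence zero.
  have hinj : Function.Injective fun χ : DualGroup C ↦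
      ((⟨n χ⟩, ⟨n χ • χ, hmem χ⟩) : ULift.{u} ℕ × AddSubgroup.closure A) := by
    intro χ ψ h
    simp only [Prod.mk.injEq, ULift.up.injEq, Subtype.mk.injEq] at h
    obtain ⟨h1, h2⟩ := h
    rw [← h1] at h2
    refine ContinuousAddMonoidHom.ext fun x ↦ ?_
    rw [← sub_eq_zero]
    refine isPreconnected_univ.character_eq_zero (Set.mem_univ 0) (χ - ψ) (hn χ) (fun y _ ↦ ?_)
      (Set.mem_univ x)
    change n χ • (χ y - ψ y) = 0
    have := DFunLike.congr_fun h2 y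
    simp only [ContinuousAddMonoidHom.nsmul_apply] at this
    rw [smul_sub, this, sub_self]
  have hcard : #(DualGroup C) ≤ κ := by
    refine (mk_le_of_injective hinj).trans ?_
    rw [mk_prod]
    simp only [lift_id, mk_uLift, mk_nat, lift_aleph0]
    exact mul_le_of_le hκ hκ (mk_addSubgroup_closure_le hκ hA)
  refine weight_le_of_separating (fun χ : DualGroup C ↦ χ) (fun χ ↦ map_continuous χ)
    (fun x y h ↦ ?_) hκ hcard
  by_contra hne
  obtain ⟨χ, hχ⟩ := exists_character_ne_zero (sub_ne_zero.2 hne)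
  exact hχ (by rw [map_sub, h χ, sub_self])

/-- Translation moves any connected subset of `P` to one through 0. -/
theorem totallyDisconnectedSpace_of_forall_isPreconnected {G : Type*} [AddCommGroup G]
    [TopologicalSpace G] [IsTopologicalAddGroup G] (P : AddSubgroup G)
    (h : ∀ t : Set G, IsPreconnected t → 0 ∈ t → t ⊆ P → t ⊆ {0}) :
    TotallyDisconnectedSpace P := by
  refine ⟨fun t _ ht x hx y hy ↦ ?_⟩
  have h1 : IsPreconnected ((fun z : P ↦ (z : G) - x) '' t) :=
    ht.image _ (by fun_prop)
  have := h _ h1 ⟨x, hx, sub_self _⟩ (by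
    rintro _ ⟨z, -, rfl⟩
    exact P.sub_mem z.2 x.2) ⟨y, hy, rfl⟩
  exact (Subtype.ext (sub_eq_zero.1 this)).symm

end Torsion

/-! ### Covering dimension -/

section CoveringDimension

theorem coveringDimension_ne_top {X : Type u} [TopologicalSpace X] {N : ℕ}
    (h : HasCoveringDimensionLT X N) : coveringDimension X ≠ ⊤ := by
  -- The bound N - 1 is not needed; N is finite already.
  have h1 : coveringDimension X ≤ ((N : ℕ∞) : WithBot ℕ∞) := by
    refine sInf_le fun n hn U hU hUo hUc ↦ ?_
    obtain ⟨V, hV1, hV2, hV3, hV4, hV5⟩ := h U hU hUo hUc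
    refine ⟨V, hV1, hV2, hV3, hV4, fun x ↦ (hV5 x).trans ?_⟩
    have : (N : ℕ∞) < n := by exact_mod_cast hn
    exact this.le
  refine (h1.trans_lt ?_).ne
  rw [← WithBot.coe_top, WithBot.coe_lt_coe]
  exact ENat.natCast_lt_top N

/-- The box with index `k` in the mesh of size `ε`, pulled back along `g`. -/
def meshBox {X ι : Type*} (g : ι → X → ℝ) (ε : ℝ) (k : ι → ℤ) : Set X :=
  {x | ∀ i, |g i x / ε - k i| < 1}

theorem mem_meshBox_floor {X ι : Type*} (g : ι → X → ℝ) (ε : ℝ) (x : X) :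
    x ∈ meshBox g ε fun i ↦ ⌊g i x / ε⌋ := by
  intro i
  rw [abs_lt]
  constructor <;> linarith [Int.floor_le (g i x / ε), Int.lt_floor_add_one (g i x / ε)]

theorem isOpen_meshBox {X ι : Type*} [TopologicalSpace X] [Finite ι] {g : ι → X → ℝ}
    (hg : ∀ i, Continuous (g i)) (ε : ℝ) (k : ι → ℤ) : IsOpen (meshBox g ε k) := by
  have : meshBox g ε k = ⋂ i, {x | |g i x / ε - k i| < 1} := by
    ext x; simp [meshBox]
  rw [this]
  exact isOpen_iInter_of_finite fun i ↦
    isOpen_lt (((hg i).div_const ε).sub continuous_const).abs continuous_const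

theorem abs_sub_lt_of_mem_meshBox {X ι : Type*} {g : ι → X → ℝ} {ε : ℝ} (hε : 0 < ε)
    {k : ι → ℤ} {x y : X} (hx : x ∈ meshBox g ε k) (hy : y ∈ meshBox g ε k) (i : ι) :
    |g i x - g i y| < 2 * ε := by
  have h1 := abs_lt.1 (hx i)
  have h2 := abs_lt.1 (hy i)
  have h3 : g i x - g i y = (g i x / ε - g i y / ε) * ε := by field_simp
  rw [h3, abs_mul, abs_of_pos hε]
  refine mul_lt_mul_of_pos_right ?_ hε
  rw [abs_lt]
  constructor <;> linarith

/-- In each coordinate only the floor and its successor lie within distance less than 1. The bound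
does not depend on `ε`, so the mesh can be refined freely. -/
theorem encard_setOf_mem_meshBox_le {X ι : Type*} [Fintype ι] (g : ι → X → ℝ) (ε : ℝ) (x : X) :
    {k | x ∈ meshBox g ε k}.encard ≤ ((2 ^ Fintype.card ι : ℕ) : ℕ∞) := by
  classical
  let F : Finset (ι → ℤ) := Fintype.piFinset fun i ↦ {⌊g i x / ε⌋, ⌊g i x / ε⌋ + 1}
  have hsub : {k | x ∈ meshBox g ε k} ⊆ (F : Set (ι → ℤ)) := by
    intro k hk
    rw [Finset.mem_coe, Fintype.mem_piFinset]
    intro i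
    have h := abs_lt.1 (hk i)
    have h1 : ⌊g i x / ε⌋ - 1 < k i := by
      have := Int.floor_le (g i x / ε)
      have h' : ((⌊g i x / ε⌋ - 1 : ℤ) : ℝ) < k i := by push_cast; linarith
      exact_mod_cast h'
    have h2 : k i < ⌊g i x / ε⌋ + 2 := by
      have := Int.lt_floor_add_one (g i x / ε)
      have h' : ((k i : ℤ) : ℝ) < ((⌊g i x / ε⌋ + 2 : ℤ) : ℝ) := by push_cast; linarith
      exact_mod_cast h'
    rw [Finset.mem_insert, Finset.mem_singleton]
    lia
  refine (Set.encard_le_encard hsub).trans ?_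
  rw [Set.encard_coe_eq_coe_finsetCard, Nat.cast_le, Fintype.card_piFinset]
  refine (Finset.prod_le_pow_card _ _ 2 fun i _ ↦ Finset.card_le_two).trans_eq ?_
  rw [Finset.card_univ]

/-- A neighbourhood of the common kernel of finitely many characters is controlled by the real and
imaginary parts of these characters. -/
theorem exists_pos_forall_sub_mem {K : Type*} [AddCommGroup K] [TopologicalSpace K]
    [CompactSpace K] (S : Finset (DualGroup K)) {O : Set K} (hO : IsOpen O)
    (hSO : (annihilator (S : Set (DualGroup K)) : Set K) ⊆ O) :
    ∃ ε > 0, ∀ x y : K,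
      (∀ χ ∈ S, |(χ.toComplex x).re - (χ.toComplex y).re| < 2 * ε ∧
        |(χ.toComplex x).im - (χ.toComplex y).im| < 2 * ε) → x - y ∈ O := by
  let m : K → ℝ := fun z ↦ ∑ χ ∈ S, ‖χ.toComplex z - 1‖
  have hm : Continuous m := by
    refine continuous_finsetSum _ fun χ _ ↦ ?_
    exact (χ.toComplex.continuous.sub continuous_const).norm
  have hpos : ∀ z ∈ Oᶜ, 0 < m z := by
    intro z hz
    have h0 : 0 ≤ m z := Finset.sum_nonneg fun _ _ ↦ norm_nonneg _
    refine lt_of_le_of_ne h0 fun h ↦ hz (hSO fun χ hχ ↦ ?_)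
    have := (Finset.sum_eq_zero_iff_of_nonneg fun _ _ ↦ norm_nonneg _).1 h.symm χ hχ
    rw [norm_eq_zero, sub_eq_zero] at this
    exact DualGroup.toComplex_apply_eq_one.1 this
  obtain ⟨δ, hδ, hδm⟩ : ∃ δ > 0, ∀ z ∈ Oᶜ, δ ≤ m z := by
    rcases Set.eq_empty_or_nonempty Oᶜ with he | hne
    · exact ⟨1, one_pos, fun z hz ↦ by simp [he] at hz⟩
    · obtain ⟨z, hz, hmin⟩ := hO.isClosed_compl.isCompact.exists_isMinOn hne hm.continuousOn
      exact ⟨m z, hpos z hz, fun w hw ↦ hmin hw⟩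
  -- Each summand of `m (x - y)` is at most 4ε, by its real and imaginary parts, so the sum stays
  -- below δ. The added 1 covers empty `S` and makes the inequality strict.
  refine ⟨δ / (4 * S.card + 1), by positivity, fun x y hxy ↦ ?_⟩
  set ε := δ / (4 * S.card + 1) with hε
  by_contra hO'
  have h1 : m (x - y) ≤ ∑ χ ∈ S, 4 * ε := by
    refine Finset.sum_le_sum fun χ hχ ↦ ?_
    have h2 : χ.toComplex x = χ.toComplex (x - y) * χ.toComplex y := by
      rw [← DualGroup.toComplex_map_add, sub_add_cancel]
    have h3 : ‖χ.toComplex (x - y) - 1‖ = ‖χ.toComplex x - χ.toComplex y‖ := by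
      have : χ.toComplex x - χ.toComplex y = (χ.toComplex (x - y) - 1) * χ.toComplex y := by
        rw [h2]; ring
      rw [this, norm_mul, DualGroup.toComplex_apply χ y, Circle.norm_coe, mul_one]
    rw [h3]
    refine (Complex.norm_le_abs_re_add_abs_im _).trans ?_
    rw [Complex.sub_re, Complex.sub_im]
    linarith [(hxy χ hχ).1, (hxy χ hχ).2]
  rw [Finset.sum_const, nsmul_eq_mul] at h1
  have h4 := hδm _ hO'
  have h5 : ε * (4 * S.card + 1) = δ := by rw [hε]; field_simp
  have h6 : 0 < ε := by positivity
  nlinarith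

open scoped Uniformity in
theorem exists_nhds_zero_forall_add_mem {K : Type*} [AddCommGroup K] [TopologicalSpace K]
    [IsTopologicalAddGroup K] [CompactSpace K] {U : Set (Set K)} (hU : ∀ u ∈ U, IsOpen u)
    (hc : ⋃₀ U = Set.univ) :
    ∃ W ∈ 𝓝 (0 : K), ∀ x, ∃ u ∈ U, ∀ w ∈ W, x + w ∈ u := by
  let _ : UniformSpace K := IsTopologicalAddGroup.rightUniformSpace K
  have _ : IsUniformAddGroup K := isUniformAddGroup_of_addCommGroup
  obtain ⟨V, hV, h⟩ := lebesgue_number_lemma_sUnion (isCompact_univ (X := K)) hU hc.ge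
  rw [uniformity_eq_comap_nhds_zero K, Filter.mem_comap] at hV
  obtain ⟨W, hW, hWV⟩ := hV
  refine ⟨W, hW, fun x ↦ ?_⟩
  obtain ⟨u, hu, hxu⟩ := h x (Set.mem_univ x)
  exact ⟨u, hu, fun w hw ↦ hxu (hWV (by simpa using hw))⟩

/-- A compact group has finite covering dimension if finitely many of its characters have a
totally disconnected common kernel. -/
theorem hasCoveringDimensionLT_of_totallyDisconnected_annihilator {K : Type u} [AddCommGroup K]
    [TopologicalSpace K] [IsTopologicalAddGroup K] [T2Space K] [CompactSpace K]
    (S : Finset (DualGroup K))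
    (hS : TotallyDisconnectedSpace (annihilator (S : Set (DualGroup K)))) :
    HasCoveringDimensionLT K (2 ^ Fintype.card (S ⊕ S)) := by
  classical
  intro U _ hUo hUc
  set P := annihilator (S : Set (DualGroup K)) with hPdef
  have hPc : CompactSpace P :=
    isCompact_iff_compactSpace.1 (isClosed_annihilator _).isCompact
  obtain ⟨W, hW, hWU⟩ := exists_nhds_zero_forall_add_mem hUo hUc
  obtain ⟨W₁, hW₁o, hW₁0, hW₁⟩ := exists_open_nhds_zero_add_subset hW
  obtain ⟨Z, hZ, h0Z, hZW⟩ := compact_exists_isClopen_in_isOpen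
    (hW₁o.preimage (continuous_subtype_val (p := fun x ↦ x ∈ P))) (x := 0) hW₁0
  obtain ⟨P₀, hP₀⟩ := IsTopologicalAddGroup.exist_openAddSubgroup_sub_clopen_nhds_of_zero hZ h0Z
  have hfin : Finite (P ⧸ P₀.toAddSubgroup) :=
    AddSubgroup.quotient_finite_of_isOpen _ P₀.isOpen
  obtain ⟨O, hO, hOP⟩ := isOpen_induced_iff.1 P₀.isOpen
  have h0O : (0 : K) ∈ O := by
    have : (0 : P) ∈ Subtype.val ⁻¹' O := by rw [hOP]; exact P₀.zero_mem
    exact this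
  obtain ⟨W₂, hW₂, hW₂O⟩ := exists_nhds_half_neg (hO.mem_nhds h0O)
  obtain ⟨W', hW's, hW'o, hW'0⟩ := mem_nhds_iff.1
    (Filter.inter_mem hW₂ (hW₁o.mem_nhds hW₁0))
  let g : S ⊕ S → K → ℝ := Sum.elim (fun χ x ↦ (χ.1.toComplex x).re)
    (fun χ x ↦ (χ.1.toComplex x).im)
  have hg : ∀ i, Continuous (g i) := by
    rintro (χ | χ)
    · exact Complex.continuous_re.comp χ.1.toComplex.continuous
    · exact Complex.continuous_im.comp χ.1.toComplex.continuous
  -- `Q` is P + W'. For small ε, two points of one mesh box differ by an element of `Q`, so each box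
  -- lies in a translate of P + W'.
  let Q : Set K := ⋃ p ∈ P, (fun x ↦ x - p) ⁻¹' W'
  have hQ : IsOpen Q := isOpen_biUnion fun p _ ↦ hW'o.preimage (by fun_prop)
  obtain ⟨ε, hε, hεQ⟩ := exists_pos_forall_sub_mem S hQ (fun p hp ↦ by
    simp only [Q, Set.mem_iUnion]
    exact ⟨p, hp, by simpa using hW'0⟩)
  obtain ⟨J, hJ⟩ := (isCompact_univ (X := K)).elim_finite_subcover (meshBox g ε)
    (isOpen_meshBox hg ε) (fun x _ ↦ Set.mem_iUnion.2 ⟨_, mem_meshBox_floor g ε x⟩)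
  -- A base point of each box; the value 0 for an empty box is never used.
  let a : (S ⊕ S → ℤ) → K := fun k ↦ if h : (meshBox g ε k).Nonempty then h.some else 0
  have ha : ∀ k x, x ∈ meshBox g ε k → x - a k ∈ Q := by
    intro k x hx
    have hak : a k ∈ meshBox g ε k := by
      have hne : (meshBox g ε k).Nonempty := ⟨x, hx⟩
      simp only [a, dif_pos hne]
      exact hne.some_mem
    exact hεQ _ _ fun χ hχ ↦ ⟨abs_sub_lt_of_mem_meshBox hε hx hak (.inl ⟨χ, hχ⟩),
      abs_sub_lt_of_mem_meshBox hε hx hak (.inr ⟨χ, hχ⟩)⟩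
  -- Each box is cut along the finitely many cosets of P₀ in P. The pieces lie in translates of P₀ +
  -- W' ⊆ W₁ + W₁ ⊆ W, hence in members of `U`.
  let v : (S ⊕ S → ℤ) → P ⧸ P₀.toAddSubgroup → Set K := fun k q ↦
    meshBox g ε k ∩ ⋃ p ∈ P₀, (fun x ↦ x - a k - q.out - p) ⁻¹' W'
  have hmem : ∀ k q x, x ∈ v k q ↔ x ∈ meshBox g ε k ∧
      ∃ p ∈ P₀, x - a k - q.out - p ∈ W' := by
    intro k q x
    simp [v]
  -- Pieces of one box are disjoint: a common point puts the difference of the two coset elements in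
  -- O ∩ P = P₀. Cutting therefore does not raise the multiplicity above that of the boxes.
  have huniq : ∀ k q q' x, x ∈ v k q → x ∈ v k q' → q = q' := by
    intro k q q' x hx hx'
    rw [hmem] at hx hx'
    obtain ⟨-, p, hp, hw⟩ := hx
    obtain ⟨-, p', hp', hw'⟩ := hx'
    have h1 : (-(q.out) + q'.out + (p' - p) : P) ∈ P₀ := by
      have h2 := hW₂O _ (hW's hw).1 _ (hW's hw').1
      have h3 : (-(q.out) + q'.out + (p' - p) : P) ∈ Subtype.val ⁻¹' O := by
        rw [Set.mem_preimage]
        convert! h2 using 1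
        push_cast
        abel
      rw [hOP] at h3
      exact h3
    have h4 : (-(q.out) + q'.out : P) ∈ P₀.toAddSubgroup := by
      have := P₀.toAddSubgroup.sub_mem h1 (P₀.toAddSubgroup.sub_mem hp' hp)
      rwa [add_sub_cancel_right] at this
    have h5 := QuotientAddGroup.eq.2 h4
    simpa using! h5
  refine ⟨Set.image2 v J Set.univ, J.finite_toSet.image2 _ Set.finite_univ, ?_, ?_, ?_, ?_⟩
  · rintro _ ⟨k, -, q, -, rfl⟩
    exact (isOpen_meshBox hg ε k).inter
      (isOpen_biUnion fun p _ ↦ hW'o.preimage (by fun_prop))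
  · rw [Set.eq_univ_iff_forall]
    intro x
    obtain ⟨k, hk⟩ := Set.mem_iUnion.1 (hJ (Set.mem_univ x))
    obtain ⟨hkJ, hxk⟩ := Set.mem_iUnion.1 hk
    have hxQ := ha k x hxk
    simp only [Q, Set.mem_iUnion] at hxQ
    obtain ⟨p, hp, hw⟩ := hxQ
    let q : P ⧸ P₀.toAddSubgroup := ((⟨p, hp⟩ : P) : P ⧸ P₀.toAddSubgroup)
    refine ⟨v k q, ⟨k, hkJ, q, Set.mem_univ q, rfl⟩, ?_⟩
    rw [hmem]
    refine ⟨hxk, -q.out + ⟨p, hp⟩, ?_, ?_⟩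
    · exact QuotientAddGroup.eq.1 (Quotient.out_eq' q)
    · rw [Set.mem_preimage] at hw
      convert! hw using 1
      push_cast
      abel
  · rintro _ ⟨k, -, q, -, rfl⟩
    obtain ⟨u, hu, hxu⟩ := hWU (a k + q.out)
    refine ⟨u, hu, fun x hx ↦ ?_⟩
    rw [hmem] at hx
    obtain ⟨-, p, hp, hw⟩ := hx
    have h1 : (p : K) ∈ W₁ := hZW (hP₀ hp)
    have h2 := hxu _ (hW₁ (Set.add_mem_add h1 (hW's hw).2))
    convert! h2 using 1
    abel
  · intro x
    let F : (S ⊕ S → ℤ) → Set K := fun k ↦ if h : ∃ q, x ∈ v k q then v k h.choose else ∅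
    have hsub : {w ∈ Set.image2 v J Set.univ | x ∈ w} ⊆ F '' {k | x ∈ meshBox g ε k} := by
      rintro _ ⟨⟨k, -, q, -, rfl⟩, hx⟩
      refine ⟨k, ((hmem k q x).1 hx).1, ?_⟩
      have hex : ∃ q, x ∈ v k q := ⟨q, hx⟩
      simp only [F, dif_pos hex]
      rw [huniq k _ q x hex.choose_spec hx]
    exact (Set.encard_le_encard hsub).trans
      ((Set.encard_image_le _ _).trans (encard_setOf_mem_meshBox_le g ε x))

end CoveringDimension

/-! ### The main theorem -/

section Main

/-- A subgroup `Y` of an Abelian group either has finite rank, or maps onto `ℚ` under a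
homomorphism of the whole group that kills a prescribed finite set. -/
theorem exists_finset_or_exists_hom_rat {X : Type*} [AddCommGroup X] (F : Finset X)
    (Y : AddSubgroup X) :
    (∃ S : Finset X, ∀ χ ∈ Y, ∃ n : ℕ, 0 < n ∧ n • χ ∈ AddSubgroup.closure (S : Set X)) ∨
      ∃ g : X →+ ℚ, (∀ χ ∈ F, g χ = 0) ∧ ∀ r, ∃ χ ∈ Y, g χ = r := by
  classical
  let L := AddSubgroup.closure (F : Set X)
  let v : Y → X ⧸ L := fun y ↦ ((y : X) : X ⧸ L)
  -- A maximal independent family in the image of `Y` modulo ⟨F⟩. If it is finite, it generates that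
  -- image up to torsion; if infinite, it carries arbitrary values in ℚ.
  obtain ⟨I, hI, hmax⟩ := exists_maximal_linearIndepOn ℤ v
  by_cases hfin : I.Finite
  · left
    refine ⟨F ∪ hfin.toFinset.image Subtype.val, fun χ hχ ↦ ?_⟩
    have hIsub : ∀ y ∈ I, (y : X) ∈ AddSubgroup.closure
        ((F ∪ hfin.toFinset.image Subtype.val : Finset X) : Set X) := fun y hy ↦
      AddSubgroup.subset_closure (by
        rw [Finset.mem_coe, Finset.mem_union, Finset.mem_image]
        exact .inr ⟨y, hfin.mem_toFinset.2 hy, rfl⟩)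
    by_cases hχI : (⟨χ, hχ⟩ : Y) ∈ I
    · exact ⟨1, one_pos, by simpa using hIsub _ hχI⟩
    obtain ⟨a, ha, hspan⟩ := hmax ⟨χ, hχ⟩ hχI
    have hlift : ∀ w ∈ Submodule.span ℤ (v '' I), ∃ s ∈ AddSubgroup.closure
        ((F ∪ hfin.toFinset.image Subtype.val : Finset X) : Set X), (s : X ⧸ L) = w := by
      intro w hw
      induction hw using Submodule.span_induction with
      | mem w h =>
        obtain ⟨y, hy, rfl⟩ := h
        exact ⟨y, hIsub y hy, rfl⟩
      | zero => exact ⟨0, zero_mem _, rfl⟩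
      | add w w' _ _ h h' =>
        obtain ⟨s, hs, rfl⟩ := h
        obtain ⟨s', hs', rfl⟩ := h'
        exact ⟨s + s', add_mem hs hs', rfl⟩
      | smul c w _ h =>
        obtain ⟨s, hs, rfl⟩ := h
        exact ⟨c • s, zsmul_mem hs c, rfl⟩
    obtain ⟨s, hs, hsw⟩ := hlift _ hspan
    have hmemL : -s + a • χ ∈ L := QuotientAddGroup.eq.1 hsw
    have hmem : a • χ ∈ AddSubgroup.closure
        ((F ∪ hfin.toFinset.image Subtype.val : Finset X) : Set X) := by
      have h1 : -s + a • χ ∈ AddSubgroup.closure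
          ((F ∪ hfin.toFinset.image Subtype.val : Finset X) : Set X) :=
        AddSubgroup.closure_mono (by
          rw [Finset.coe_union]; exact Set.subset_union_left) hmemL
      simpa using add_mem hs h1
    refine ⟨a.natAbs, Int.natAbs_pos.2 ha, ?_⟩
    rw [← natCast_zsmul]
    rcases Int.natAbs_eq a with h | h
    · rwa [← h]
    · rw [← neg_neg ((a.natAbs : ℤ)), ← h, neg_smul]
      exact neg_mem hmem
  · right
    have hinf : Infinite I := Set.infinite_coe_iff.2 hfin
    let e : ℚ ↪ I := (Denumerable.eqv ℚ).toEmbedding.trans (Infinite.natEmbedding I)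
    obtain ⟨h, hh⟩ : ∃ h : I → ℚ, Function.Surjective h :=
      ⟨Function.invFun e, Function.invFun_surjective e.injective⟩
    let f : (I →₀ ℤ) →ₗ[ℤ] X ⧸ L := Finsupp.linearCombination ℤ fun i : I ↦ v i
    have hf : Function.Injective f := hI
    -- ℚ is divisible, hence injective, so the map given on the free group over `I` extends to all
    -- of X/⟨F⟩.
    obtain ⟨g, hg⟩ := (Module.Baer.of_divisible ℚ).extension_property_addMonoidHom
      f.toAddMonoidHom hf (Finsupp.linearCombination ℤ h).toAddMonoidHom
    refine ⟨g.comp (QuotientAddGroup.mk' L), fun χ hχ ↦ ?_, fun r ↦ ?_⟩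
    · have : (χ : X ⧸ L) = 0 :=
        (QuotientAddGroup.eq_zero_iff χ).2 (AddSubgroup.subset_closure hχ)
      change g (χ : X ⧸ L) = 0
      rw [this, map_zero]
    · obtain ⟨i, rfl⟩ := hh r
      refine ⟨i.1, i.1.2, ?_⟩
      have := DFunLike.congr_fun hg (Finsupp.single i 1)
      simpa [f, v] using! this

theorem IsPreconnected.exists_mem_connectedComponentOfZero {K : Type*} [AddCommGroup K]
    [TopologicalSpace K] [IsTopologicalAddGroup K] {M : AddSubgroup K} {t : Set K}
    (ht : IsPreconnected t) (h0 : 0 ∈ t) (htM : t ⊆ M) {x : K} (hx : x ∈ t) :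
    ∃ y : AddSubgroup.connectedComponentOfZero M, ((y : M) : K) = x := by
  have h1 : IsPreconnected ((Subtype.val : M → K) ⁻¹' t) := by
    have h2 : (Subtype.val : M → K) '' (Subtype.val ⁻¹' t) = t :=
      Set.image_preimage_eq_of_subset (by simpa using htM)
    exact IsInducing.subtypeVal.isPreconnected_image.1 (h2.symm ▸ ht)
  exact ⟨⟨⟨x, htM hx⟩, h1.subset_connectedComponent (x := 0) h0 hx⟩, rfl⟩

variable {K : Type u} [AddCommGroup K] [TopologicalSpace K] [IsTopologicalAddGroup K]
  [T2Space K] [CompactSpace K]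

-- Every basic neighbourhood of `o` contains the preimage of the annihilator of finitely many
-- characters, and these neighbourhoods meet only in `o`.
open Cardinal in
theorem exists_characters_mk_le_weight {H : Type u} [TopologicalSpace H] [T1Space H]
    {f : H → K} (hf : IsInducing f) {o : H} (ho : f o = 0) (hw : ℵ₀ ≤ weight H) :
    ∃ A : Set (DualGroup K), #A ≤ weight H ∧ ∀ x, f x ∈ annihilator A → x = o := by
  obtain ⟨B, hB, hBw⟩ := exists_isTopologicalBasis_mk_eq_weight H
  have hF : ∀ b : B, ∃ F : Finset (DualGroup K), o ∈ (b : Set H) →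
      ∀ x, f x ∈ annihilator (F : Set (DualGroup K)) → x ∈ (b : Set H) := by
    intro b
    by_cases hob : o ∈ (b : Set H)
    · have hb : (b : Set H) ∈ 𝓝 o := (hB.isOpen b.2).mem_nhds hob
      rw [hf.nhds_eq_comap, Filter.mem_comap, ho] at hb
      obtain ⟨U, hU, hUb⟩ := hb
      obtain ⟨F, hF⟩ := exists_finset_annihilator_subset hU
      exact ⟨F, fun _ x hx ↦ hUb (hF hx)⟩
    · exact ⟨∅, fun h ↦ (hob h).elim⟩
  choose F hF using hF
  refine ⟨⋃ b : B, (F b : Set (DualGroup K)), ?_, fun x hx ↦ ?_⟩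
  · refine (mk_iUnion_le _).trans (mul_le_of_le hw hBw.le (ciSup_le' fun b ↦ ?_))
    exact (F b).countable_toSet.le_aleph0.trans hw
  · by_contra hne
    obtain ⟨b, hb, hob, hbx⟩ := hB.exists_subset_of_mem_open (show o ∈ ({x}ᶜ : Set H) from
      fun h ↦ hne h.symm) isOpen_compl_singleton
    exact hbx (hF ⟨b, hb⟩ hob x (annihilator_anti (Set.subset_iUnion
      (fun b : B ↦ (F b : Set (DualGroup K))) ⟨b, hb⟩) hx)) rfl

open Cardinal in
/-- If few characters suffice to force connected sets into `M`, then the connected component of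
`K` has at most the weight of the connected component of `M`. -/
theorem weight_connectedComponentOfZero_le {M : AddSubgroup K}
    (hM : AddSubgroup.connectedComponentOfZero M ≠ ⊥) (B : Set (DualGroup K)) (hB : B.Countable)
    (hBM : ∀ t : Set K, IsPreconnected t → 0 ∈ t → t ⊆ annihilator B → t ⊆ M) :
    weight (AddSubgroup.connectedComponentOfZero K) ≤
      weight (AddSubgroup.connectedComponentOfZero M) := by
  have hconn (L : Type u) [AddCommGroup L] [TopologicalSpace L] [IsTopologicalAddGroup L] :
      ConnectedSpace (AddSubgroup.connectedComponentOfZero L) :=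
    isConnected_iff_connectedSpace.1 (isConnected_connectedComponent (x := (0 : L)))
  have := hconn M
  have := hconn K
  have : CompactSpace (AddSubgroup.connectedComponentOfZero K) :=
    isCompact_iff_compactSpace.1 (isClosed_connectedComponent (x := (0 : K))).isCompact
  have : Nontrivial (AddSubgroup.connectedComponentOfZero M) :=
    (AddSubgroup.nontrivial_iff_ne_bot _).2 hM
  -- Infinite weight absorbs the countable set `B`.
  have hw := aleph0_le_weight (AddSubgroup.connectedComponentOfZero M)
  obtain ⟨A, hA, hAM⟩ := exists_characters_mk_le_weight (K := K)
    (f := fun y : AddSubgroup.connectedComponentOfZero M ↦ ((y : M) : K))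
    (IsInducing.subtypeVal.comp IsInducing.subtypeVal) (o := 0) rfl hw
  let ρ : AddSubgroup.connectedComponentOfZero K →ₜ+ K :=
    ⟨(AddSubgroup.connectedComponentOfZero K).subtype, continuous_subtype_val⟩
  refine weight_le_of_totallyDisconnected_annihilator
    ((fun χ : DualGroup K ↦ χ.comp ρ) '' (A ∪ B)) ?_ hw ?_
  · refine totallyDisconnectedSpace_of_forall_isPreconnected _ fun t ht h0 hts x hx ↦ ?_
    have ht' : IsPreconnected (ρ '' t) := ht.image _ (map_continuous ρ).continuousOn
    have h0' : (0 : K) ∈ ρ '' t := ⟨0, h0, map_zero ρ⟩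
    have hann : ρ '' t ⊆ annihilator (A ∪ B) := by
      rintro _ ⟨y, hy, rfl⟩ χ hχ
      exact hts hy _ ⟨χ, hχ, rfl⟩
    have htM := hBM _ ht' h0' (hann.trans (annihilator_anti Set.subset_union_right))
    obtain ⟨y, hy⟩ := ht'.exists_mem_connectedComponentOfZero h0' htM ⟨x, hx, rfl⟩
    have hyA : ((y : M) : K) ∈ annihilator A := by
      rw [hy]
      exact annihilator_anti Set.subset_union_left (hann ⟨x, hx, rfl⟩)
    have hy0 := hAM y hyA
    rw [hy0] at hy
    exact Subtype.ext hy.symm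
  · exact mk_image_le.trans ((mk_union_le _ _).trans
      (add_le_of_le hw hA (hB.le_aleph0.trans hw)))

theorem exists_countable_annihilator_le_of_isGδ {M : AddSubgroup K} (hM : IsGδ (M : Set K)) :
    ∃ B : Set (DualGroup K), B.Countable ∧ annihilator B ≤ M := by
  obtain ⟨T, hTo, hTc, hMT⟩ := hM
  have h : ∀ U : T, ∃ F : Finset (DualGroup K),
      (annihilator (F : Set (DualGroup K)) : Set K) ⊆ U := by
    intro U
    refine exists_finset_annihilator_subset ((hTo U U.2).mem_nhds ?_)
    have : (0 : K) ∈ ⋂₀ T := hMT ▸ M.zero_mem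
    exact this U U.2
  choose F hF using h
  have := hTc.to_subtype
  refine ⟨⋃ U : T, (F U : Set (DualGroup K)),
    Set.countable_iUnion fun U ↦ (F U).countable_toSet, fun x hx ↦ ?_⟩
  rw [← SetLike.mem_coe, hMT]
  intro U hU
  exact hF ⟨U, hU⟩ (annihilator_anti (Set.subset_iUnion
    (fun U : T ↦ (F U : Set (DualGroup K))) ⟨U, hU⟩) hx)

/-- The annihilator of a closed locally essential subgroup has finite rank. -/
theorem exists_finset_of_isLocallyEssential {M : AddSubgroup K}
    (h : IsLocallyEssential M) :
    ∃ S : Finset (DualGroup K), ∀ χ : DualGroup K, (∀ x ∈ M, χ x = 0) →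
      ∃ n : ℕ, 0 < n ∧ n • χ ∈ AddSubgroup.closure (S : Set (DualGroup K)) := by
  obtain ⟨V, hV, hess⟩ := h
  obtain ⟨F, hF⟩ := exists_finset_annihilator_subset hV
  let Y : AddSubgroup (DualGroup K) :=
    { carrier := {χ | ∀ x ∈ M, χ x = 0}
      zero_mem' := fun _ _ ↦ rfl
      add_mem' := fun {χ ψ} h1 h2 x hx ↦ by
        rw [ContinuousAddMonoidHom.add_apply, h1 x hx, h2 x hx, add_zero]
      neg_mem' := fun {χ} h1 x hx ↦ by
        rw [show (-χ) x = -(χ x) from rfl, h1 x hx, neg_zero] }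
  rcases exists_finset_or_exists_hom_rat F Y with hS | ⟨g, hgF, hgY⟩
  · exact hS
  exfalso
  -- `N` lies in `V` because `g` kills `F`, and it is non-trivial because `g` is not zero. It meets
  -- `M` only in 0, since `g` maps `Y` onto ℚ and so the dual is `Y` + ker g.
  let N := annihilator (g.ker : Set (DualGroup K))
  have hNV : (N : Set K) ⊆ V :=
    fun x hx ↦ hF (annihilator_anti (fun χ hχ ↦ hgF χ hχ) hx)
  have hN : N ≠ ⊥ := by
    intro hbot
    obtain ⟨χ, -, hχ⟩ := hgY 1
    have : χ ∈ g.ker := by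
      rw [eq_top_of_annihilator_eq_bot hbot]; exact AddSubgroup.mem_top χ
    rw [AddMonoidHom.mem_ker, hχ] at this
    exact one_ne_zero this
  refine hess N inferInstance (isClosed_annihilator _) hN hNV ?_
  rw [eq_bot_iff]
  rintro x ⟨hxM, hxN⟩
  by_contra hx
  obtain ⟨χ, hχ⟩ := exists_character_ne_zero (show x ≠ 0 from hx)
  obtain ⟨ψ, hψ, hψg⟩ := hgY (g χ)
  have h1 : (χ - ψ) x = 0 := hxN (χ - ψ) (show χ - ψ ∈ g.ker by
    rw [AddMonoidHom.mem_ker, map_sub, hψg, sub_self])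
  have h2 : χ x - ψ x = 0 := h1
  rw [hψ x hxM, sub_zero] at h2
  exact hχ h2

end Main

theorem mainTheorem11 {K : Type u} [AddCommGroup K] [TopologicalSpace K]
    [IsTopologicalAddGroup K] [T2Space K] [CompactSpace K]
    (M : AddSubgroup K) (hM : IsClosed (M : Set K))
    (h : (IsGδ (M : Set K) ∧ AddSubgroup.connectedComponentOfZero M ≠ ⊥) ∨
      (IsLocallyEssential M ∧ coveringDimension K = ⊤)) :
    weight (AddSubgroup.connectedComponentOfZero M) =
      weight (AddSubgroup.connectedComponentOfZero K) := by
  refine le_antisymm ?_ ?_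
  · let f : AddSubgroup.connectedComponentOfZero M → AddSubgroup.connectedComponentOfZero K :=
      fun y ↦ ⟨((y : M) : K), continuous_subtype_val.image_connectedComponent_subset (0 : M)
        ⟨y, y.2, rfl⟩⟩
    have hval : IsInducing (Subtype.val : M → K) := IsInducing.subtypeVal
    have hf : IsInducing f := IsInducing.of_comp (g := Subtype.val)
      (Continuous.subtype_mk (continuous_subtype_val.comp continuous_subtype_val) _)
      continuous_subtype_val
      (hval.comp IsInducing.subtypeVal)
    exact hf.weight_le
  rcases h with ⟨hG, hne⟩ | ⟨hE, hdim⟩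
  · obtain ⟨B, hB, hBM⟩ := exists_countable_annihilator_le_of_isGδ hG
    exact weight_connectedComponentOfZero_le hne B hB fun t _ _ htB ↦ htB.trans hBM
  · obtain ⟨S, hS⟩ := exists_finset_of_isLocallyEssential hE
    -- A character vanishing on `M` has a positive multiple in ⟨S⟩, so it is torsion on the
    -- annihilator of `S` and vanishes on connected sets through 0 there. Closedness of `M` then
    -- gives t ⊆ M.
    have hSM : ∀ t : Set K, IsPreconnected t → 0 ∈ t →
        t ⊆ annihilator (S : Set (DualGroup K)) → t ⊆ M := by
      intro t ht h0 htS x hx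
      by_contra hxM
      obtain ⟨χ, hχM, hχ⟩ := exists_character_of_notMem hM hxM
      obtain ⟨n, hn, hmem⟩ := hS χ hχM
      refine hχ (ht.character_eq_zero h0 χ hn (fun y hy ↦ ?_) hx)
      rw [← ContinuousAddMonoidHom.nsmul_apply]
      exact apply_eq_zero_of_mem_closure hmem (htS hy)
    -- Infinite dimension serves only to exclude c(M) = 0, which would make the annihilator of `S`
    -- totally disconnected.
    refine weight_connectedComponentOfZero_le (fun hbot ↦ ?_) S S.countable_toSet hSM
    refine coveringDimension_ne_top
      (hasCoveringDimensionLT_of_totallyDisconnected_annihilator S ?_) hdim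
    refine totallyDisconnectedSpace_of_forall_isPreconnected _ fun t ht h0 htS x hx ↦ ?_
    obtain ⟨y, hy⟩ := ht.exists_mem_connectedComponentOfZero h0 (hSM t ht h0 htS) hx
    have hy0 : (y : M) = 0 := (AddSubgroup.eq_bot_iff_forall _).1 hbot y y.2
    rw [hy0] at hy
    exact hy.symm
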